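/- Corollary 5.1. Let $F$ be a number field with ring of integers $O_F$. An Arakelov divisor is a formal sum $D=\sum_P x_P P+\sum_\sigma x_\sigma\sigma$, where $P$ runs over the maximal ideals of $O_F$, $x_P\in\mathbb Z$ is zero for almost all $P$, $\sigma$ runs over the infinite places of $F$, and $x_\sigma\in\mathbb R$. Let $I=\prod_P P^{-x_P}$ be its fractional ideal, embedded as a lattice in $I\otimes\mathbb R=F\otimes_{\mathbb Q}\mathbb R=\prod_\sigma F_\sigma$. For $z=(z_\sigma)\in F\otimes\mathbb R$ put $$\|z\|_D^2=\sum_{\sigma\text{ real}}|z_\sigma|^2e^{-2x_\sigma}+\sum_{\sigma\text{ complex}}|z_\sigma|^2\cdot 2e^{-x_\sigma},\qquad u_D(z)=e^{-\pi\|z\|_D^2}.$$ Ghost-spaces. For a locally compact abelian group $G$ and a continuous, strictly positive, positive-definite function $u:G\to\mathbb R$ with $u(0)=1$, the ghost-space of the first kind $G_u$ is $G$ with the convolution $\delta_x*\delta_y=\frac{u(x)u(y)}{u(x+y)}\delta_{x+y}$; it is finite-dimensional with respect to a Haar measure $m$ if $u$ is $m$-integrable, and then $\dim_m G_u=\log\int_G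 u\,dm$. If $G$ is discrete, $\dim G_u$ is taken with $m$ the counting measure. For an even, positive-definite probability measure $\mu$ on $G$ (positive-definite: $\int_G (f*\tilde f)\,d\mu\ge 0$ for all $f\in C_c(G)$, where $\tilde f(x)=\overline{f(-x)}$), the ghost-space of the second kind $G^\mu$ is $G$ with the convolution $\delta_x*\delta_y=T_{x+y}\mu$, where $T_{x+y}$ is the shift by $x+y$; if $G$ is compact with Haar probability measure $m$, and $\mu=f\cdot m$ with $f\ge 0$ continuous and $f(0)>0$, then $G^\mu$ is finite-dimensional and $\dim G^\mu=\log f(0)$. For a closed subgroup $H\subseteq G$ with Haar measure $m_H$, the quotient $G_u/H_u$ is $(G/H)_v$ with $v(x+H)=\int_H u(x+y)\,dm_H(y)\big/\int_H u\,dm_H$, and the quotient $G/G_u$ is $G^\mu$ with $\mu$ the probability measure proportional to $u$ times a Haar measure of $G$. Cohomology. Put $$H^0(D)=I_{u_D},\qquad H^1(D)=\big((I\otimes\mathbb R)/I\big)\big/\big((I\otimes\mathbb R)_{u_D}/I_{u_D}\big),$$ and $h^i(D)=\dim H^i(D)$. Thus $$h^0(D)=\log\sum_{x\in I}e^{-\pi\|x\|_D^2},$$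 and $h^1(D)$ is the logarithm of the value at $0$ of the continuous density, with respect to the Haar probability measure of $(F\otimes\mathbb R)/I$, of the probability measure on $(F\otimes\mathbb R)/I$ whose density is proportional to $\overline x\mapsto\sum_{y\in I}e^{-\pi\|x+y\|_D^2}$. Let $K$ be the canonical Arakelov divisor: its fractional ideal is the inverse $\partial^{-1}$ of the different of $F$, and its infinite components are zero. Then for every Arakelov divisor $D$ the ghost-spaces $H^0(K-D)$ (of the first kind) and $H^1(D)$ (of the second kind) are well defined, including the ghost-spaces of the first kind $(I\otimes\mathbb R)_{u_D}$, $I_{u_D}$ (which is finite-dimensional) and $(I\otimes\mathbb R)_{u_D}/I_{u_D}$ used to form $H^1(D)$; both are finite-dimensional, and $$h^1(D)=h^0(K-D).$$ -/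

import Mathlib

open MeasureTheory NumberField IsDedekindDomain
open scoped nonZeroDivisors ENNReal ComplexOrder

noncomputable section

namespace Ghost

section Definitions

variable {G : Type*} [AddCommGroup G]

/-- A complex function on an abelian group is positive-definite if all the matrices
`(f (x j - x i))` are hermitian and nonnegative-definite. -/
def PosDefFun (f : G → ℂ) : Prop :=
  ∀ (n : ℕ) (x : Fin n → G), (Matrix.of fun i j => f (x j - x i)).PosSemidef

variable [TopologicalSpace G]

/-- The functions `u` that define a ghost-space of the first kind `G_u`, that is, the group `G`
with the convolution `δ_x * δ_y = (u x * u y / u (x + y)) • δ_(x + y)`. The ghost-space is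
determined by `u`, and `u` by the convolution, so `G_u` is represented by `u`. -/
structure IsFirstKind (u : G → ℝ) : Prop where
  pos : ∀ x, 0 < u x
  map_zero : u 0 = 1
  continuous : Continuous u
  posDef : PosDefFun fun x => (u x : ℂ)

variable [MeasurableSpace G]

/-- A measure `μ` is positive-definite if `∫ (f * f~) dμ ≥ 0` for all continuous compactly
supported complex functions `f`, where `f~ x = conj (f (-x))` and the convolution
`(f * f~) x = ∫ f y * conj (f (y - x)) dm y` is taken with respect to a Haar measure `m`. -/
def PosDefMeasure (μ : Measure G) : Prop :=
  ∀ (m : Measure G) [m.IsAddHaarMeasure] (f : G → ℂ), Continuous f → HasCompactSupport f →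
    0 ≤ ∫ x, (∫ y, f y * starRingEnd ℂ (f (y - x)) ∂m) ∂μ

/-- The measures `μ` that define a ghost-space of the second kind `G^μ`, that is, the group `G`
with the convolution `δ_x * δ_y = T_(x + y) μ`. The ghost-space is determined by `μ`, and `μ`
by the convolution, so `G^μ` is represented by `μ`. -/
structure IsSecondKind (μ : Measure G) : Prop where
  isProbability : IsProbabilityMeasure μ
  even : μ.map (fun x => -x) = μ
  posDef : PosDefMeasure μ

/-- `G_u` has finite dimension with respect to the Haar measure `m`. -/
def FiniteDimFirst (m : Measure G) (u : G → ℝ) : Prop := Integrable u m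

/-- The dimension of `G_u` with respect to the Haar measure `m`. -/
def dimFirst (m : Measure G) (u : G → ℝ) : ℝ := Real.log (∫ x, u x ∂m)

/-- The absolute dimension of `G_u` for discrete `G`: the Haar measure is the counting measure. -/
def absDimFirst [DiscreteTopology G] (u : G → ℝ) : ℝ := dimFirst Measure.count u

/-- `f` is a continuous density of `μ` with respect to `m`. There is at most one if `m` is a Haar
measure, see `IsDensity.unique`; it gives a meaning to the value of the density at a point. -/
structure IsDensity (m μ : Measure G) (f : G → ℝ) : Prop where
  continuous : Continuous f
  nonneg : ∀ x, 0 ≤ f x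
  eq_withDensity : μ = m.withDensity fun x => ENNReal.ofReal (f x)

theorem IsDensity.unique {G : Type*} [TopologicalSpace G] [MeasurableSpace G] [OpensMeasurableSpace G] {m μ : Measure G} [m.IsOpenPosMeasure]
    [SigmaFinite m] {f g : G → ℝ} (hf : IsDensity m μ f) (hg : IsDensity m μ g) : f = g := by
  have h : (fun x => ENNReal.ofReal (f x)) =ᵐ[m] fun x => ENNReal.ofReal (g x) :=
    (withDensity_eq_iff_of_sigmaFinite
      (ENNReal.measurable_ofReal.comp hf.continuous.measurable).aemeasurable
      (ENNReal.measurable_ofReal.comp hg.continuous.measurable).aemeasurable).1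
      (hf.eq_withDensity ▸ hg.eq_withDensity)
  refine (Continuous.ae_eq_iff_eq m hf.continuous hg.continuous).1 ?_
  filter_upwards [h] with x hx
  exact (ENNReal.ofReal_eq_ofReal_iff (hf.nonneg x) (hg.nonneg x)).1 hx

/-- `G^μ` has finite dimension with respect to the Haar measure `m`. -/
def FiniteDimSecond (m μ : Measure G) : Prop := ∃ f, IsDensity m μ f ∧ 0 < f 0

open scoped Classical in
/-- The dimension of `G^μ` with respect to the Haar measure `m`: the logarithm of the value at `0`
of the density of `μ` with respect to `m`. -/
def dimSecond (m μ : Measure G) : ℝ :=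
  if h : ∃ f, IsDensity m μ f then Real.log (h.choose 0) else 0

/-- The Haar probability measure of a compact group. -/
def haarProb (G : Type*) [AddCommGroup G] [TopologicalSpace G] [IsTopologicalAddGroup G]
    [CompactSpace G] [MeasurableSpace G] [BorelSpace G] : Measure G :=
  Measure.addHaarMeasure ⊤

/-- The absolute dimension of `G^μ` for compact `G`: the Haar measure is the probability one. -/
def absDimSecond [IsTopologicalAddGroup G] [CompactSpace G] [BorelSpace G]
    (μ : Measure G) : ℝ := dimSecond (haarProb G) μ

/-- The quotient `G / G_u` is the ghost-space of the second kind `G^μ`, where `μ` is the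
probability measure proportional to `u • m`, for a Haar measure `m` on `G`. -/
def quotientMeasure (m : Measure G) (u : G → ℝ) : Measure G :=
  (∫⁻ x, ENNReal.ofReal (u x) ∂m)⁻¹ • m.withDensity fun x => ENNReal.ofReal (u x)

instance (H : AddSubgroup G) [MeasurableAdd G] : MeasurableAdd H where
  measurable_const_add c := (measurable_subtype_coe.const_add (c : G)).subtype_mk
  measurable_add_const c := (measurable_subtype_coe.add_const (c : G)).subtype_mk

/-- The quotient `G_u / H_u` is the ghost-space of the first kind `(G / H)_v`, where
`v (x + H) = (∫_H u (x + y) dm y) / (∫_H u y dm y)` for a Haar measure `m` on `H`. -/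
def quotientFun [MeasurableAdd G] (H : AddSubgroup G) (m : Measure H) [m.IsAddLeftInvariant]
    (u : G → ℝ) : G ⧸ H → ℝ :=
  Quotient.lift (fun x : G => (∫ y : H, u (x + y) ∂m) / ∫ y : H, u y ∂m) (by
    intro a b hab
    have hab' : -a + b ∈ H := QuotientAddGroup.leftRel_apply.1 hab
    have h := integral_add_left_eq_self (μ := m) (fun y : H => u (a + y)) ⟨-a + b, hab'⟩
    have h' : ∀ y : H, u (a + ((⟨-a + b, hab'⟩ + y : H) : G)) = u (b + y) := fun y => by
      congr 1
      push_cast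
      abel
    simp only [h'] at h
    simp only [h])

end Definitions

end Ghost

/-- An Arakelov divisor `∑ x_P P + ∑ x_σ σ` on the number field `F`: integer coefficients, almost
all zero, at the maximal ideals of `𝓞 F`, and real coefficients at the infinite places. -/
abbrev ArakelovDivisor (F : Type*) [Field F] [NumberField F] : Type _ :=
  (HeightOneSpectrum (𝓞 F) →₀ ℤ) × (InfinitePlace F → ℝ)

namespace ArakelovDivisor

open Ghost

variable {F : Type*} [Field F] [NumberField F]

/-- The fractional ideal `I = ∏ P ^ (-x_P)` of an Arakelov divisor. -/
def ideal (D : ArakelovDivisor F) : (FractionalIdeal (𝓞 F)⁰ F)ˣ :=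
  D.1.prod fun P n =>
    (Units.mk0 (P.asIdeal : FractionalIdeal (𝓞 F)⁰ F)
      (FractionalIdeal.coeIdeal_ne_zero.mpr P.ne_bot)) ^ (-n)

/-- The fractional ideal `I` as a subgroup of `I ⊗ ℝ = F ⊗ ℝ = ∏_σ F_σ`. -/
abbrev lattice (D : ArakelovDivisor F) : AddSubgroup (mixedEmbedding.mixedSpace F) :=
  (mixedEmbedding.idealLattice F D.ideal).toAddSubgroup

instance (D : ArakelovDivisor F) : DiscreteTopology D.lattice :=
  inferInstanceAs (DiscreteTopology (mixedEmbedding.idealLattice F D.ideal))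

open scoped Classical in
instance (D : ArakelovDivisor F) : CompactSpace (mixedEmbedding.mixedSpace F ⧸ D.lattice) := by
  refine ⟨?_⟩
  rw [← (QuotientAddGroup.mk_surjective (s := D.lattice)).range_eq]
  refine IsZLattice.isCompact_range_of_periodic (mixedEmbedding.idealLattice F D.ideal) _
    QuotientAddGroup.continuous_mk fun z w hw => ?_
  exact (QuotientAddGroup.mk_add_of_mem z hw)

instance (D : ArakelovDivisor F) :
    IsClosed (D.lattice : Set (mixedEmbedding.mixedSpace F)) :=
  AddSubgroup.isClosed_of_discrete

open scoped Classical in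
/-- The square of the hermitian norm `‖z‖_D` on `F ⊗ ℝ`. -/
def normSq (D : ArakelovDivisor F) (z : mixedEmbedding.mixedSpace F) : ℝ :=
  ∑ σ : {w : InfinitePlace F // w.IsReal}, |z.1 σ| ^ 2 * Real.exp (-2 * D.2 σ) +
    ∑ σ : {w : InfinitePlace F // w.IsComplex}, ‖z.2 σ‖ ^ 2 * (2 * Real.exp (-D.2 σ))

/-- The function `u x = exp (-π ‖x‖_D ^ 2)` on `F ⊗ ℝ`. -/
def gaussian (D : ArakelovDivisor F) (z : mixedEmbedding.mixedSpace F) : ℝ :=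
  Real.exp (-Real.pi * D.normSq z)

/-- `H⁰(D) = I_u`, a ghost-space of the first kind. -/
def H0 (D : ArakelovDivisor F) : D.lattice → ℝ := fun x => D.gaussian x

/-- `h⁰(D) = dim H⁰(D)`. -/
def h0 (D : ArakelovDivisor F) : ℝ := absDimFirst D.H0

/-- The ghost-space of the first kind `(I ⊗ ℝ)_u / I_u = ((I ⊗ ℝ) / I)_v`. -/
def cechQuotient (D : ArakelovDivisor F) : mixedEmbedding.mixedSpace F ⧸ D.lattice → ℝ :=
  quotientFun D.lattice Measure.count D.gaussian

/-- `H¹(D) = ((I ⊗ ℝ) / I) / ((I ⊗ ℝ)_u / I_u)`, a ghost-space of the second kind. -/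
def H1 (D : ArakelovDivisor F) : Measure (mixedEmbedding.mixedSpace F ⧸ D.lattice) :=
  quotientMeasure (haarProb _) D.cechQuotient

/-- `h¹(D) = dim H¹(D)`. -/
def h1 (D : ArakelovDivisor F) : ℝ := absDimSecond D.H1

variable (F) in
/-- The canonical Arakelov divisor: its fractional ideal is the inverse of the different, see
`ideal_canonical`, and its infinite components are zero. -/
def canonical : ArakelovDivisor F :=
  (Finsupp.ofSupportFinite
    (fun P => FractionalIdeal.count F P (differentIdeal ℤ (𝓞 F) : FractionalIdeal (𝓞 F)⁰ F))
    (FractionalIdeal.finite_factors _), 0)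

variable (F) in
theorem ideal_canonical :
    ((canonical F).ideal : FractionalIdeal (𝓞 F)⁰ F) =
      (differentIdeal ℤ (𝓞 F) : FractionalIdeal (𝓞 F)⁰ F)⁻¹ := by
  have h0 : (differentIdeal ℤ (𝓞 F) : FractionalIdeal (𝓞 F)⁰ F) ≠ 0 :=
    FractionalIdeal.coeIdeal_ne_zero.mpr differentIdeal_ne_bot
  rw [← FractionalIdeal.finprod_heightOneSpectrum_factorization' F (inv_ne_zero h0),
    finprod_eq_finsetProd_of_mulSupport_subset (s := (canonical F).1.support)]
  · simp only [ideal, Finsupp.prod, Units.coe_prod, Units.val_zpow_eq_zpow_val, Units.val_mk0,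
      FractionalIdeal.count_inv]
    rfl
  · intro P hP
    simp only [Function.mem_mulSupport, FractionalIdeal.count_inv] at hP
    simp only [Finset.mem_coe, Finsupp.mem_support_iff]
    intro h
    apply hP
    have h' : FractionalIdeal.count F P
        (differentIdeal ℤ (𝓞 F) : FractionalIdeal (𝓞 F)⁰ F) = 0 := h
    rw [h', neg_zero, zpow_zero]

end ArakelovDivisor

end

/-! The equality is Poisson summation read at the origin. Summing the Gaussian of `D` over `I` gives
a theta function on the torus `(F ⊗ ℝ) / I`, and `H¹(D)` has density `theta` divided by its mean.
The characters of the torus come from the dual of `I` for the trace form, which is the ideal of `K -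
D` (`ideal_canonical_sub`, `mem_lattice_of_pairing`). The Fourier transform of the Gaussian of `D`
for that form is a constant times the Gaussian with opposite infinite components, that is, of `K -
D` (`integral_gaussian_mul_fourierChar`). Hence the density has the Fourier coefficients `exp (-π
‖w‖²)` for the norm of `K - D`, and its value at `0` is the sum whose logarithm is `h⁰(K - D)`.
Dividing by the mean cancels covolume and total mass, so neither is ever computed.

Poisson summation (`theta_eq_thetaMean_mul_dualSeries`) follows by comparing Fourier coefficients:
those of `theta` come from unfolding (`integral_mul_tsum_eq_integral_mul`), those of the series from
orthogonality, and by Stone–Weierstrass they determine a continuous function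
(`eq_zero_of_integral_mul_char_eq_zero`).

All positive-definiteness claims have the same source: the function or density is a superposition of
characters with nonnegative weights. -/

noncomputable section

namespace Ghost

/-! ### Positive-definite functions. -/

section PositiveDefinite

variable {G W : Type*} [AddCommGroup G]

theorem continuous_coe_circle : Continuous fun z : Circle => (z : ℂ) := continuous_subtype_val

theorem coe_char_sub (χ : AddChar G Circle) (x y : G) :
    (χ (x - y) : ℂ) = χ x * starRingEnd ℂ (χ y : ℂ) := by
  rw [AddChar.map_sub_eq_div, Circle.coe_div, div_eq_mul_inv, ← Circle.coe_inv,
    Circle.coe_inv_eq_conj]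

theorem coe_char_neg (χ : AddChar G Circle) (x : G) :
    (χ (-x) : ℂ) = starRingEnd ℂ (χ x : ℂ) := by
  rw [AddChar.map_neg_eq_inv, Circle.coe_inv_eq_conj]

/-- A superposition of characters with nonnegative weights is positive-definite. -/
theorem posDefFun_of_eq_integral [MeasurableSpace W] (ν : Measure W) {p : W → ℝ}
    (hp : Integrable p ν) (hp0 : ∀ w, 0 ≤ p w) (χ : W → AddChar G Circle)
    (hχ : ∀ x, Measurable fun w => (χ w x : ℂ)) {f : G → ℂ}
    (hf : ∀ x, f x = ∫ w, (p w : ℂ) * χ w x ∂ν) : PosDefFun f := by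
  have hint : ∀ x, Integrable (fun w => (p w : ℂ) * χ w x) ν := fun x => by
    exact hp.ofReal.mul_bdd (c := 1) (hχ x).aestronglyMeasurable
      (.of_forall fun w => (Circle.norm_coe _).le)
  intro n x
  refine Matrix.PosSemidef.of_dotProduct_mulVec_nonneg (Matrix.IsHermitian.ext fun i j => ?_)
    fun c => ?_
  · simp only [Matrix.of_apply, hf, ← starRingEnd_apply]
    rw [← integral_conj]
    congr 1 with w
    rw [map_mul, Complex.conj_ofReal, ← coe_char_neg, neg_sub]
  -- The quadratic form of a single character is a squared modulus; integrating against `p` keeps it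
  -- nonnegative.
  · have h : star c ⬝ᵥ (Matrix.of fun i j => f (x j - x i)).mulVec c =
        ∫ w, ((p w * ‖∑ j, c j * χ w (x j)‖ ^ 2 : ℝ) : ℂ) ∂ν := by
      simp only [dotProduct, Matrix.mulVec, Matrix.of_apply, Pi.star_apply, hf, Finset.mul_sum,
        ← integral_const_mul, ← integral_mul_const]
      have hint' : ∀ i j, Integrable
          (fun w => star (c i) * ((p w : ℂ) * (χ w (x j - x i)) * c j)) ν :=
        fun i j => ((hint _).mul_const _).const_mul _
      simp_rw [← integral_finsetSum _ fun j _ => hint' _ j]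
      rw [← integral_finsetSum _ fun i _ => integrable_finsetSum _ fun j _ => hint' i j]
      congr 1 with w
      · rw [Complex.ofReal_mul, Complex.ofReal_pow, ← Complex.conj_mul', map_sum,
          Finset.sum_mul_sum, Finset.mul_sum]
        refine Finset.sum_congr rfl fun i _ => ?_
        rw [Finset.mul_sum]
        refine Finset.sum_congr rfl fun j _ => ?_
        rw [coe_char_sub, map_mul, ← starRingEnd_apply]
        ring
    rw [h, integral_complex_ofReal]
    exact Complex.zero_le_real.2 (integral_nonneg fun w => mul_nonneg (hp0 w) (by positivity))

theorem IsFirstKind.comp_subtype [TopologicalSpace G] {u : G → ℝ} (hu : IsFirstKind u)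
    (H : AddSubgroup G) : IsFirstKind fun x : H => u x where
  pos x := hu.pos x
  map_zero := hu.map_zero
  continuous := hu.continuous.comp continuous_subtype_val
  posDef n x := hu.posDef n fun i => (x i : G)

end PositiveDefinite

/-! ### Characters of a quotient group. -/

section LiftChar

variable {V : Type*} [AddCommGroup V] {L : AddSubgroup V}

variable (L) in
/-- The character of a quotient group induced by a character that is trivial on the subgroup. -/
def liftChar (χ : AddChar V Circle) (h : ∀ x ∈ L, χ x = 1) : AddChar (V ⧸ L) Circle where
  toFun := Quotient.lift χ fun a b hab => by
    have h' := h _ (QuotientAddGroup.leftRel_apply.1 hab)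
    rw [← add_neg_cancel_left a b, AddChar.map_add_eq_mul, h', mul_one]
  map_zero_eq_one' := χ.map_zero_eq_one
  map_add_eq_mul' x y := by
    induction x using QuotientAddGroup.induction_on with | _ x
    induction y using QuotientAddGroup.induction_on with | _ y
    exact χ.map_add_eq_mul x y

theorem liftChar_mk (χ : AddChar V Circle) (h : ∀ x ∈ L, χ x = 1) (x : V) :
    liftChar L χ h (x : V ⧸ L) = χ x := rfl

theorem continuous_liftChar [TopologicalSpace V] {χ : AddChar V Circle} (hχ : Continuous χ)
    (h : ∀ x ∈ L, χ x = 1) : Continuous (liftChar L χ h) :=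
  hχ.quotient_lift _

end LiftChar

/-! ### Fourier analysis on a compact abelian group. -/

section CompactGroup

variable {G W : Type*} [AddCommGroup G] [TopologicalSpace G] [IsTopologicalAddGroup G]
  [CompactSpace G] [MeasurableSpace G] [BorelSpace G]

instance : IsProbabilityMeasure (haarProb G) :=
  ⟨Measure.addHaarMeasure_self (K₀ := (⊤ : TopologicalSpace.PositiveCompacts G))⟩

instance : (haarProb G).IsAddHaarMeasure := by
  unfold haarProb; infer_instance

/-- Translating by `a` multiplies the integral by `χ a`, which differs from `1`. -/
theorem integral_char_eq_zero {χ : AddChar G Circle} {a : G} (ha : χ a ≠ 1) :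
    ∫ x, (χ x : ℂ) ∂haarProb G = 0 := by
  have h := integral_add_left_eq_self (μ := haarProb G) (fun x => (χ x : ℂ)) a
  simp only [AddChar.map_add_eq_mul, Circle.coe_mul, integral_const_mul] at h
  have ha' : (χ a : ℂ) - 1 ≠ 0 := fun e => ha (Circle.coe_eq_one.1 (sub_eq_zero.1 e))
  exact (mul_eq_zero.1 (show ((χ a : ℂ) - 1) * _ = 0 by
    rw [sub_mul, one_mul, h, sub_self])).resolve_left ha'

instance : (haarProb G).IsNegInvariant := by
  have : (haarProb G).Regular := by unfold haarProb; infer_instance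
  infer_instance

theorem map_neg_withDensity {f : G → ℝ≥0∞} (hf : Measurable f) (hfn : ∀ x, f (-x) = f x) :
    ((haarProb G).withDensity f).map (fun x => -x) = (haarProb G).withDensity f := by
  ext s hs
  rw [Measure.map_apply measurable_neg hs, withDensity_apply _ hs,
    withDensity_apply _ (measurable_neg hs)]
  have h := (Measure.measurePreserving_neg (haarProb G)).setLIntegral_comp_preimage hs hf
  simpa only [hfn] using h

/-- A density that is an absolutely convergent Fourier series with nonnegative coefficients
defines a positive-definite measure. -/
theorem posDefMeasure_withDensity [SecondCountableTopology G] [Countable W] {p : W → ℝ}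
    (hp : Summable p) (hp0 : ∀ w, 0 ≤ p w) (χ : W → AddChar G Circle)
    (hχ : ∀ w, Continuous (χ w)) {f : G → ℝ} (hfc : Continuous f) (hf0 : ∀ x, 0 ≤ f x)
    (hf : ∀ x, (f x : ℂ) = ∑' w, (p w : ℂ) * χ w x) :
    PosDefMeasure ((haarProb G).withDensity fun x => ENNReal.ofReal (f x)) := by
  intro m _ φ hφ _
  set h := haarProb G with hh
  -- The definition quantifies over all Haar measures `m`; by uniqueness only a nonnegative factor
  -- is at stake.
  obtain ⟨c, hc⟩ : ∃ c : NNReal, m = c • h := ⟨_, Measure.isAddLeftInvariant_eq_smul m h⟩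
  have hχ' : ∀ w, Continuous fun x => (χ w x : ℂ) := fun w =>
    continuous_coe_circle.comp (hχ w)
  have hkc : Continuous fun z : G × G => φ z.2 * starRingEnd ℂ (φ (z.2 - z.1)) := by fun_prop
  have hk : Integrable (fun z : G × G => φ z.2 * starRingEnd ℂ (φ (z.2 - z.1))) (h.prod m) :=
    hkc.integrable_of_hasCompactSupport (HasCompactSupport.of_compactSpace _)
  have hF : Integrable (fun x => ∫ y, φ y * starRingEnd ℂ (φ (y - x)) ∂m) h :=
    hk.integral_prod_left
  have hterm : ∀ w, 0 ≤ ∫ x, (χ w x : ℂ) * (∫ y, φ y * starRingEnd ℂ (φ (y - x)) ∂m) ∂h := by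
    intro w
    have hk' : Integrable (fun z : G × G =>
        (χ w z.1 : ℂ) * (φ z.2 * starRingEnd ℂ (φ (z.2 - z.1)))) (h.prod m) :=
      (((hχ' w).comp continuous_fst).mul hkc).integrable_of_hasCompactSupport
        (HasCompactSupport.of_compactSpace _)
    -- The Fourier transform turns `φ * φ~` into a squared modulus; after Fubini the substitution `x
    -- ↦ y - x` separates the variables.
    have e : ∫ x, (χ w x : ℂ) * (∫ y, φ y * starRingEnd ℂ (φ (y - x)) ∂m) ∂h =
        ((c : ℝ) * ‖∫ y, φ y * χ w y ∂h‖ ^ 2 : ℝ) := by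
      simp_rw [← integral_const_mul]
      rw [integral_integral_swap hk']
      have e1 : ∀ y, ∫ x, (χ w x : ℂ) * (φ y * starRingEnd ℂ (φ (y - x))) ∂h =
          φ y * χ w y * starRingEnd ℂ (∫ x, φ x * χ w x ∂h) := fun y => by
        rw [← integral_conj, ← integral_sub_left_eq_self _ h y, ← integral_const_mul]
        congr 1 with x
        rw [coe_char_sub, map_mul, sub_sub_cancel]
        ring
      simp_rw [e1]
      rw [integral_mul_const, hc, integral_smul_nnreal_measure, NNReal.smul_def, Complex.real_smul,
        mul_assoc, Complex.mul_conj']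
      push_cast
      rfl
    rw [e]
    exact Complex.zero_le_real.2 (by positivity)
  rw [integral_withDensity_eq_integral_toReal_smul (by fun_prop) (by simp)]
  have e2 : ∀ x, (ENNReal.ofReal (f x)).toReal • (∫ y, φ y * starRingEnd ℂ (φ (y - x)) ∂m) =
      ∑' w, (p w : ℂ) * ((χ w x : ℂ) * ∫ y, φ y * starRingEnd ℂ (φ (y - x)) ∂m) := fun x => by
    rw [ENNReal.toReal_ofReal (hf0 x), Complex.real_smul, hf, ← tsum_mul_right]
    simp only [mul_assoc]
  simp_rw [e2]
  have hs := hasSum_integral_of_summable_integral_norm (μ := h)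
    (F := fun w x => (p w : ℂ) * ((χ w x : ℂ) * ∫ y, φ y * starRingEnd ℂ (φ (y - x)) ∂m))
    (fun w => (hF.bdd_mul (c := 1) (hχ' w).aestronglyMeasurable
      (.of_forall fun x => (Circle.norm_coe _).le)).const_mul _) (by
      simp only [norm_mul, Circle.norm_coe, one_mul, integral_const_mul, Complex.norm_real,
        Real.norm_of_nonneg (hp0 _)]
      exact hp.mul_right _)
  refine hs.nonneg fun w => ?_
  rw [integral_const_mul]
  exact mul_nonneg (Complex.zero_le_real.2 (hp0 w)) (hterm w)

/-- A continuous function on a compact group whose Fourier coefficients at a point-separating group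
of characters vanish is zero. -/
theorem eq_zero_of_integral_mul_char_eq_zero [AddCommGroup W] (μ : Measure G) [IsFiniteMeasure μ]
    [μ.IsOpenPosMeasure] (χ : AddChar W (AddChar G Circle)) (hχ : ∀ w, Continuous (χ w))
    (hsep : ∀ x, (∀ w, χ w x = 1) → x = 0) {d : G → ℂ} (hd : Continuous d)
    (h : ∀ w, ∫ x, (χ w x : ℂ) * d x ∂μ = 0) : d = 0 := by
  let e : W → C(G, ℂ) := fun w => ⟨fun x => (χ w x : ℂ), continuous_coe_circle.comp (hχ w)⟩
  let A : StarSubalgebra ℂ C(G, ℂ) :=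
    { toSubalgebra := Algebra.adjoin ℂ (Set.range e)
      -- The conjugate of the character of `w` is the character of `-w`.
      star_mem' := by
        change Algebra.adjoin ℂ (Set.range e) ≤ star (Algebra.adjoin ℂ (Set.range e))
        refine Algebra.adjoin_le ?_
        rintro - ⟨w, rfl⟩
        refine Algebra.subset_adjoin ⟨-w, ContinuousMap.ext fun x => ?_⟩
        simp only [e, ContinuousMap.coe_mk, ContinuousMap.star_apply, AddChar.map_neg_eq_inv,
          AddChar.inv_apply, Circle.coe_inv_eq_conj]
        rfl }
  -- The characters are closed under products, so the algebra they generate is their linear span,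
  -- and vanishing on characters suffices.
  have hspan : Subalgebra.toSubmodule A.toSubalgebra = Submodule.span ℂ (Set.range e) := by
    refine Algebra.adjoin_eq_span_of_subset _ (Set.Subset.trans ?_ Submodule.subset_span)
    intro x hx
    refine Submonoid.closure_induction (fun _ => id) ⟨0, ?_⟩ ?_ hx
    · ext x; simp [e]
    · rintro - - - - ⟨m, rfl⟩ ⟨n, rfl⟩
      exact ⟨m + n, by ext x; simp [e, AddChar.map_add_eq_mul]⟩
  have hA : A.SeparatesPoints := by
    intro x y hxy
    by_contra! hcon
    refine hxy (sub_eq_zero.1 (hsep _ fun w => ?_))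
    have := hcon (e w) ⟨e w, Algebra.subset_adjoin ⟨w, rfl⟩, rfl⟩
    rw [AddChar.map_sub_eq_div, div_eq_one]
    exact Subtype.ext this
  have htop := ContinuousMap.starSubalgebra_topologicalClosure_eq_top_of_separatesPoints A hA
  let D : C(G, ℂ) := ⟨d, hd⟩
  have hint : ∀ g : C(G, ℂ), Integrable g μ := fun g =>
    g.continuous.integrable_of_hasCompactSupport (HasCompactSupport.of_compactSpace _)
  have hcont : Continuous fun g : C(G, ℂ) => ∫ x, (g * D) x ∂μ :=
    (continuous_integral.comp (ContinuousMap.toLp (E := ℂ) 1 μ ℂ).continuous).comp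
      (continuous_mul_const D) |>.congr fun g =>
        integral_congr_ae (ContinuousMap.coeFn_toLp (𝕜 := ℂ) μ (g * D))
  have hall : ∀ g : C(G, ℂ), ∫ x, (g * D) x ∂μ = 0 := by
    intro g
    have hg : g ∈ closure (A : Set C(G, ℂ)) := by
      have : g ∈ A.topologicalClosure := htop ▸ StarSubalgebra.mem_top
      exact this
    refine closure_minimal (t := {g : C(G, ℂ) | ∫ x, (g * D) x ∂μ = 0}) ?_
      (isClosed_eq hcont continuous_const) hg
    intro g hg
    have hg' : g ∈ Submodule.span ℂ (Set.range e) := hspan ▸ hg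
    clear hg
    induction hg' using Submodule.span_induction with
    | mem x hx => obtain ⟨w, rfl⟩ := hx; exact h w
    | zero => simp
    | add x y hx hy ix iy =>
      change ∫ z, ((x + y) * D) z ∂μ = 0
      simp only [add_mul, ContinuousMap.add_apply]
      rw [integral_add (hint _) (hint _), ix, iy, add_zero]
    | smul a x hx ix =>
      change ∫ z, ((a • x) * D) z ∂μ = 0
      simp only [smul_mul_assoc, ContinuousMap.smul_apply]
      rw [integral_smul, ix, smul_zero]
  -- Testing `d` against its own conjugate gives `∫ ‖d‖² = 0`.
  have h1 := hall (star D)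
  have h2 : ∀ x, (star D * D) x = ((‖d x‖ ^ 2 : ℝ) : ℂ) := fun x => by
    push_cast
    exact Complex.conj_mul' (d x)
  simp_rw [h2, integral_complex_ofReal] at h1
  have hd2 : Continuous fun x => ‖d x‖ ^ 2 := by fun_prop
  rw [Complex.ofReal_eq_zero, integral_eq_zero_iff_of_nonneg (fun x => by positivity)
    (hd2.integrable_of_hasCompactSupport (HasCompactSupport.of_compactSpace _)),
    Continuous.ae_eq_iff_eq μ hd2 continuous_zero] at h1
  funext x
  simpa using congr_fun h1 x

end CompactGroup

/-! ### Unfolding over a discrete cocompact subgroup. -/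

section Quotient

variable {V : Type*} [AddCommGroup V] [TopologicalSpace V] [IsTopologicalAddGroup V]
  [MeasurableSpace V] [BorelSpace V] [PolishSpace V]

/-- Unfolding an integral over the quotient by a discrete cocompact subgroup. -/
theorem integral_mul_tsum_eq_integral_mul (L : AddSubgroup V)
    [Countable L] [CompactSpace (V ⧸ L)] [T2Space (V ⧸ L)] (ν : Measure V) [ν.IsAddHaarMeasure]
    [SigmaFinite ν] {s : Set V} (hs : IsAddFundamentalDomain L.op s ν) (hs' : ν s ≠ ⊤)
    {f : V → ℂ} (hf : Integrable f ν) {g S : V ⧸ L → ℂ} (hg : Continuous g) (hS : Continuous S)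
    (hfS : ∀ x : V, S x = ∑' y : L, f (x + y)) :
    (ν.real s : ℂ) * ∫ x, g x * S x ∂(haarProb (V ⧸ L)) = ∫ x : V, g (x : V ⧸ L) * f x ∂ν := by
  have hμ := IsFundamentalDomain.AddQuotientMeasureEqMeasurePreimage_vaddAddHaarMeasure ν ⊤ hs hs'
  have hm := hμ.addProjection_respects_measure' s hs
  have hA : QuotientAddGroup.automorphize f = S := by
    funext x
    induction x using QuotientAddGroup.induction_on with | _ x
    rw [hfS]
    exact (AddSubgroup.equivOp L).symm.tsum_eq fun y : L => f (x + y)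
  -- The image of `ν` restricted to a fundamental domain is invariant of total mass `ν s`, whence
  -- the factor.
  have hm' : Measure.map (QuotientAddGroup.mk (s := L)) (ν.restrict s) =
      ν s • haarProb (V ⧸ L) := by
    refine hm.symm.trans ?_
    simp [haarProb]
  obtain ⟨C, hC⟩ := (isCompact_range hg.norm).bddAbove
  rw [QuotientAddGroup.integral_mul_eq_integral_automorphize_mul hs hf hg.aestronglyMeasurable
    (ne_top_of_le_ne_top (ENNReal.ofReal_ne_top (r := C)) ?_) (hA ▸ hS.aestronglyMeasurable), hA,
    hm', integral_smul_measure, Complex.real_smul]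
  · rfl
  · refine essSup_le_of_ae_le _ (.of_forall fun x => ?_)
    exact (ofReal_norm (g x)).symm.le.trans (ENNReal.ofReal_le_ofReal (hC ⟨x, rfl⟩))

end Quotient

end Ghost

/-- The Fourier transform of a Gaussian, up to the constant given by its total mass. -/
theorem integral_cexp_neg_mul_sq_norm_add_eq {E : Type*} [NormedAddCommGroup E]
    [InnerProductSpace ℝ E] [FiniteDimensional ℝ E] [MeasurableSpace E] [BorelSpace E]
    {b : ℝ} (hb : 0 < b) (c : ℂ) (w : E) :
    ∫ v : E, Complex.exp (-b * ‖v‖ ^ 2 + c * inner ℝ w v) =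
      Complex.exp (c ^ 2 * ‖w‖ ^ 2 / (4 * b)) * ∫ v : E, Complex.exp (-b * ‖v‖ ^ 2) := by
  have h := GaussianFourier.integral_cexp_neg_mul_sq_norm_add (b := (b : ℂ)) (by simpa) c w
  have h0 := GaussianFourier.integral_cexp_neg_mul_sq_norm_add (b := (b : ℂ)) (by simpa) 0 w
  simp only [zero_mul, add_zero, ne_eq, OfNat.ofNat_ne_zero, not_false_eq_true, zero_pow,
    zero_div, Complex.exp_zero, mul_one] at h0
  rw [h, h0, mul_comm]

namespace ArakelovDivisor

open Ghost mixedEmbedding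

variable {F : Type*} [Field F] [NumberField F]

/-! ### The trace form on `F ⊗ ℝ`. -/

section Pairing

open scoped Classical in
/-- The extension of the trace form of `F` to `F ⊗ ℝ`. -/
def pairing (w x : mixedSpace F) : ℝ :=
  ∑ σ : {w : InfinitePlace F // w.IsReal}, w.1 σ * x.1 σ +
    ∑ σ : {w : InfinitePlace F // w.IsComplex}, 2 * (w.2 σ * x.2 σ).re

theorem pairing_comm (w x : mixedSpace F) : pairing w x = pairing x w := by
  simp only [pairing, mul_comm]

theorem pairing_add_right (w x y : mixedSpace F) :
    pairing w (x + y) = pairing w x + pairing w y := by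
  simp only [pairing, Prod.fst_add, Prod.snd_add, Pi.add_apply, mul_add, Complex.add_re,
    Finset.sum_add_distrib]
  ring

theorem pairing_smul_right (w : mixedSpace F) (t : ℝ) (x : mixedSpace F) :
    pairing w (t • x) = t * pairing w x := by
  simp only [pairing, Prod.smul_fst, Prod.smul_snd, Pi.smul_apply, smul_eq_mul, mul_add,
    Finset.mul_sum, Complex.real_smul]
  congr 1 <;> refine Finset.sum_congr rfl fun σ _ => ?_
  · ring
  · rw [mul_left_comm (w.2 σ), Complex.re_ofReal_mul]; ring

theorem pairing_add_left (w v x : mixedSpace F) :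
    pairing (w + v) x = pairing w x + pairing v x := by
  simp only [pairing_comm _ x, pairing_add_right]

theorem pairing_sum_right {ι : Type*} (s : Finset ι) (w : mixedSpace F) (x : ι → mixedSpace F) :
    pairing w (∑ i ∈ s, x i) = ∑ i ∈ s, pairing w (x i) :=
  map_sum (AddMonoidHom.mk' (pairing w) (pairing_add_right w)) x s

theorem pairing_zero_left (x : mixedSpace F) : pairing 0 x = 0 := by simp [pairing]

theorem continuous_pairing (w : mixedSpace F) : Continuous (pairing w) := by
  unfold pairing
  fun_prop

/-- The character of `F ⊗ ℝ` defined by an element. -/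
def pairingChar (w : mixedSpace F) : AddChar (mixedSpace F) Circle :=
  Real.fourierChar.compAddMonoidHom (AddMonoidHom.mk' (pairing w) (pairing_add_right w))

theorem pairingChar_apply (w x : mixedSpace F) :
    pairingChar w x = Real.fourierChar (pairing w x) := rfl

theorem continuous_pairingChar (w : mixedSpace F) : Continuous (pairingChar w) :=
  Real.continuous_fourierChar.comp (continuous_pairing w)

/-- Pairing `w` with its conjugate gives a sum of nonnegative terms that vanishes only at `w = 0`.
-/
theorem pairing_nondegenerate {w : mixedSpace F} (h : ∀ x, pairing w x = 0) : w = 0 := by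
  classical
  have h := h (w.1, fun σ => starRingEnd ℂ (w.2 σ))
  simp only [pairing, Complex.mul_conj, Complex.ofReal_re] at h
  rw [add_eq_zero_iff_of_nonneg (Finset.sum_nonneg fun σ _ => mul_self_nonneg _)
    (Finset.sum_nonneg fun σ _ => mul_nonneg zero_le_two (Complex.normSq_nonneg _)),
    Finset.sum_eq_zero_iff_of_nonneg (fun σ _ => mul_self_nonneg _),
    Finset.sum_eq_zero_iff_of_nonneg
      (fun σ _ => mul_nonneg zero_le_two (Complex.normSq_nonneg _))] at h
  refine Prod.ext (funext fun σ => ?_) (funext fun σ => ?_)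
  · simpa using h.1 σ (Finset.mem_univ _)
  · simpa using h.2 σ (Finset.mem_univ _)

/-- The trace is the sum over all embeddings into `ℂ`; a conjugate pair contributes twice a real
part, hence the factor `2` in `pairing`. -/
theorem pairing_mixedEmbedding (a b : F) :
    pairing (mixedEmbedding F a) (mixedEmbedding F b) = Algebra.trace ℚ F (a * b) := by
  classical
  have h := trace_eq_sum_embeddings ℂ (K := ℚ) (L := F) (x := a * b)
  have h' : ∑ σ : F →ₐ[ℚ] ℂ, σ (a * b) = ∑ φ : F →+* ℂ, φ (a * b) :=
    Fintype.sum_equiv (RingHom.equivRatAlgHom F ℂ).symm _ _ fun σ => rfl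
  rw [h', ← (indexEquiv F).sum_comp, Fintype.sum_sum_type, Fintype.sum_prod_type] at h
  simp only [Fin.sum_univ_two, indexEquiv_apply_isReal, indexEquiv_apply_isComplex_fst,
    indexEquiv_apply_isComplex_snd, ComplexEmbedding.conjugate_coe_eq, Complex.add_conj] at h
  rw [← Complex.ofReal_inj, pairing]
  push_cast
  simp only [eq_ratCast] at h
  rw [h]
  congr 1 <;> refine Finset.sum_congr rfl fun σ _ => ?_
  · simp [mixedEmbedding_apply_isReal]
  · simp [mixedEmbedding_apply_isComplex]

end Pairing

/-! ### The Gaussian of an Arakelov divisor and its Fourier transform. -/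

section Gaussian

variable (D : ArakelovDivisor F)

theorem normSq_nonneg (z : mixedSpace F) : 0 ≤ D.normSq z := by
  unfold normSq; positivity

theorem normSq_neg (z : mixedSpace F) : D.normSq (-z) = D.normSq z := by simp [normSq]

/-- This lets translated Gaussians be dominated by a fixed wider Gaussian, locally uniformly in the
translation. -/
theorem normSq_le_two_mul (x y : mixedSpace F) :
    D.normSq y ≤ 2 * D.normSq (x + y) + 2 * D.normSq x := by
  have hC : ∀ a b : ℂ, ‖b‖ ^ 2 ≤ 2 * ‖a + b‖ ^ 2 + 2 * ‖a‖ ^ 2 := fun a b => by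
    have h : ‖b‖ ≤ ‖a + b‖ + ‖a‖ := by simpa using norm_sub_le (a + b) a
    nlinarith [norm_nonneg b, sq_nonneg (‖a + b‖ - ‖a‖)]
  simp only [normSq, mul_add, Finset.mul_sum]
  rw [add_add_add_comm, ← Finset.sum_add_distrib, ← Finset.sum_add_distrib]
  refine add_le_add (Finset.sum_le_sum fun σ _ => ?_) (Finset.sum_le_sum fun σ _ => ?_)
  · rw [← mul_assoc, ← mul_assoc, ← add_mul]
    refine mul_le_mul_of_nonneg_right ?_ (Real.exp_nonneg _)
    simp only [sq_abs, Prod.fst_add, Pi.add_apply]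
    nlinarith [sq_nonneg (2 * x.1 σ + y.1 σ)]
  · rw [← mul_assoc, ← mul_assoc, ← mul_assoc, ← mul_assoc, ← mul_assoc, ← add_mul]
    refine mul_le_mul_of_nonneg_right ?_ (Real.exp_nonneg _)
    have := hC (x.2 σ) (y.2 σ)
    simp only [Prod.snd_add, Pi.add_apply]
    linarith

theorem continuous_normSq : Continuous D.normSq := by
  unfold normSq
  fun_prop

theorem continuous_gaussian : Continuous D.gaussian := by
  have := D.continuous_normSq
  unfold gaussian
  fun_prop

theorem gaussian_pos (z : mixedSpace F) : 0 < D.gaussian z := Real.exp_pos _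

theorem gaussian_zero : D.gaussian 0 = 1 := by simp [gaussian, normSq]

theorem gaussian_neg (z : mixedSpace F) : D.gaussian (-z) = D.gaussian z := by
  simp [gaussian, normSq_neg]

/-- The factor at a real place of a Gaussian times a character. -/
def realFactor (w : mixedSpace F) (σ : {w : InfinitePlace F // w.IsReal}) (v : ℝ) : ℂ :=
  Complex.exp (-(Real.pi * Real.exp (-2 * D.2 σ) : ℝ) * ‖v‖ ^ 2 +
    (2 * Real.pi * Complex.I) * inner ℝ (w.1 σ) v)

/-- The factor at a complex place of a Gaussian times a character. -/
def complexFactor (w : mixedSpace F) (σ : {w : InfinitePlace F // w.IsComplex}) (v : ℂ) : ℂ :=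
  Complex.exp (-(2 * Real.pi * Real.exp (-D.2 σ) : ℝ) * ‖v‖ ^ 2 +
    (4 * Real.pi * Complex.I) * inner ℝ (starRingEnd ℂ (w.2 σ)) v)

open scoped Classical in
theorem gaussian_mul_fourierChar (w z : mixedSpace F) :
    (D.gaussian z : ℂ) * Real.fourierChar (pairing w z) =
      (∏ σ, D.realFactor w σ (z.1 σ)) * ∏ σ, D.complexFactor w σ (z.2 σ) := by
  simp only [realFactor, complexFactor]
  rw [← Complex.exp_sum, ← Complex.exp_sum, ← Complex.exp_add, Real.fourierChar_apply, gaussian,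
    Complex.ofReal_exp, ← Complex.exp_add]
  congr 1
  simp only [normSq, pairing, Finset.sum_add_distrib]
  push_cast
  simp only [mul_add, add_mul, Finset.mul_sum, Finset.sum_mul]
  rw [add_add_add_comm]
  congr 1
  · congr 1 <;> refine Finset.sum_congr rfl fun σ _ => ?_
    · simp only [Real.norm_eq_abs]; ring
    · simp; ring
  · congr 1 <;> refine Finset.sum_congr rfl fun σ _ => ?_
    · ring
    · simp [Complex.inner]; ring

theorem integrable_realFactor (w : mixedSpace F) (σ : {w : InfinitePlace F // w.IsReal}) :
    Integrable (D.realFactor w σ) :=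
  GaussianFourier.integrable_cexp_neg_mul_sq_norm_add (by rw [Complex.ofReal_re]; positivity) _ _

theorem integrable_complexFactor (w : mixedSpace F) (σ : {w : InfinitePlace F // w.IsComplex}) :
    Integrable (D.complexFactor w σ) :=
  GaussianFourier.integrable_cexp_neg_mul_sq_norm_add (by rw [Complex.ofReal_re]; positivity) _ _

theorem integral_realFactor (w : mixedSpace F) (σ : {w : InfinitePlace F // w.IsReal}) :
    ∫ v, D.realFactor w σ v =
      Real.exp (-Real.pi * (|w.1 σ| ^ 2 * Real.exp (2 * D.2 σ))) *
        ∫ v, D.realFactor 0 σ v := by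
  have hb : 0 < Real.pi * Real.exp (-2 * D.2 σ) := by positivity
  have h0 : ∀ v, D.realFactor 0 σ v =
      Complex.exp (-(Real.pi * Real.exp (-2 * D.2 σ) : ℝ) * ‖v‖ ^ 2) := fun v => by
    simp [realFactor]
  simp_rw [h0]
  unfold realFactor
  rw [integral_cexp_neg_mul_sq_norm_add_eq hb, Complex.ofReal_exp]
  congr 2
  have hpi : (Real.pi : ℂ) ≠ 0 := by exact_mod_cast Real.pi_ne_zero
  rw [show -2 * D.2 σ = -(2 * D.2 σ) by ring, Real.exp_neg, Real.norm_eq_abs]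
  push_cast
  have hx := Complex.exp_ne_zero (2 * D.2 σ)
  field_simp
  simp only [Complex.I_sq]
  ring

/-- With `b = 2π exp (-x)` and `c = 4πi`, the exponent `c² / (4b)` is `-2π exp x`: the weight `2` in
the norm and the `2` in the trace form make the Gaussian self-dual up to `x ↦ -x`. -/
theorem integral_complexFactor (w : mixedSpace F) (σ : {w : InfinitePlace F // w.IsComplex}) :
    ∫ v, D.complexFactor w σ v =
      Real.exp (-Real.pi * (‖w.2 σ‖ ^ 2 * (2 * Real.exp (D.2 σ)))) *
        ∫ v, D.complexFactor 0 σ v := by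
  have hb : 0 < 2 * Real.pi * Real.exp (-D.2 σ) := by positivity
  have h0 : ∀ v, D.complexFactor 0 σ v =
      Complex.exp (-(2 * Real.pi * Real.exp (-D.2 σ) : ℝ) * ‖v‖ ^ 2) := fun v => by
    simp [complexFactor]
  simp_rw [h0]
  unfold complexFactor
  rw [integral_cexp_neg_mul_sq_norm_add_eq hb, Complex.ofReal_exp]
  congr 2
  have hpi : (Real.pi : ℂ) ≠ 0 := by exact_mod_cast Real.pi_ne_zero
  rw [Real.exp_neg, RCLike.norm_conj]
  push_cast
  have hx := Complex.exp_ne_zero (D.2 σ)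
  field_simp
  simp only [Complex.I_sq]
  ring

open scoped Classical in
theorem integrable_gaussian_mul_fourierChar (w : mixedSpace F) :
    Integrable fun z : mixedSpace F => (D.gaussian z : ℂ) * Real.fourierChar (pairing w z) := by
  have h1 : Integrable fun z : {w : InfinitePlace F // w.IsReal} → ℝ =>
      ∏ σ, D.realFactor w σ (z σ) := Integrable.fintype_prod (D.integrable_realFactor w)
  have h2 : Integrable fun z : {w : InfinitePlace F // w.IsComplex} → ℂ =>
      ∏ σ, D.complexFactor w σ (z σ) := Integrable.fintype_prod (D.integrable_complexFactor w)
  have h3 := h1.mul_prod h2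
  rw [← Measure.volume_eq_prod] at h3
  exact h3.congr (.of_forall fun z => (D.gaussian_mul_fourierChar w z).symm)

open scoped Classical in
theorem integrable_gaussian : Integrable D.gaussian := by
  have h := (D.integrable_gaussian_mul_fourierChar 0).re
  simpa [pairing_zero_left] using h

open scoped Classical in
theorem integral_gaussian_pos : 0 < ∫ z, D.gaussian z := by
  rw [integral_pos_iff_support_of_nonneg (fun z => (D.gaussian_pos z).le) D.integrable_gaussian]
  have : Function.support D.gaussian = Set.univ :=
    Set.eq_univ_of_forall fun z => (D.gaussian_pos z).ne'
  rw [this]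
  exact isOpen_univ.measure_pos _ Set.univ_nonempty

open scoped Classical in
/-- The Fourier transform, for the trace form, of the Gaussian of `D` is proportional to the
Gaussian of `-D`. -/
theorem integral_gaussian_mul_fourierChar {E : ArakelovDivisor F} (hE : E.2 = -D.2)
    (w : mixedSpace F) :
    ∫ z : mixedSpace F, (D.gaussian z : ℂ) * Real.fourierChar (pairing w z) =
      (E.gaussian w : ℂ) * ∫ z, (D.gaussian z : ℂ) := by
  have key : ∀ w : mixedSpace F,
      ∫ z : mixedSpace F, (D.gaussian z : ℂ) * Real.fourierChar (pairing w z) =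
      (E.gaussian w : ℂ) * ((∏ σ, ∫ v, D.realFactor 0 σ v) *
        ∏ σ, ∫ v, D.complexFactor 0 σ v) := by
    intro w
    simp_rw [gaussian_mul_fourierChar]
    refine (integral_prod_mul
      (fun z : {w : InfinitePlace F // w.IsReal} → ℝ => ∏ σ, D.realFactor w σ (z σ))
      (fun z : {w : InfinitePlace F // w.IsComplex} → ℂ =>
        ∏ σ, D.complexFactor w σ (z σ))).trans ?_
    rw [integral_fintype_prod_volume_eq_prod, integral_fintype_prod_volume_eq_prod]
    simp_rw [D.integral_realFactor w, D.integral_complexFactor w, Finset.prod_mul_distrib]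
    rw [mul_mul_mul_comm]
    congr 1
    rw [← Complex.ofReal_prod, ← Complex.ofReal_prod, ← Complex.ofReal_mul, ← Real.exp_sum,
      ← Real.exp_sum, ← Real.exp_add]
    simp [gaussian, normSq, hE, mul_add, Finset.mul_sum]
  -- The product of the local constants is identified with the total mass by taking `w = 0`.
  rw [key w]
  congr 1
  have h0 := key 0
  simpa [pairing_zero_left, gaussian_zero] using h0.symm

theorem isFirstKind_gaussian : IsFirstKind D.gaussian where
  pos := D.gaussian_pos
  map_zero := D.gaussian_zero
  continuous := D.continuous_gaussian
  posDef := by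
    classical
    -- Only the infinite components enter the Gaussian. That of `D` is the normalized Fourier
    -- transform of the positive Gaussian of `E`, hence a superposition of characters.
    let E : ArakelovDivisor F := (0, -D.2)
    have hpos := E.integral_gaussian_pos
    have hE : D.2 = -E.2 := by simp [E]
    refine posDefFun_of_eq_integral volume
      (p := fun w => (∫ z, E.gaussian z)⁻¹ * E.gaussian w) (E.integrable_gaussian.const_mul _)
      (fun w => mul_nonneg (inv_nonneg.2 hpos.le) (E.gaussian_pos w).le)
      pairingChar (fun x => ?_) fun x => ?_
    · refine (continuous_coe_circle.comp (Real.continuous_fourierChar.comp ?_)).measurable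
      exact (continuous_pairing x).congr fun w => pairing_comm x w
    · have h := E.integral_gaussian_mul_fourierChar hE x
      simp only [pairingChar_apply, Complex.ofReal_mul, mul_assoc, integral_const_mul,
        pairing_comm _ x]
      rw [h, integral_complex_ofReal]
      push_cast
      rw [mul_comm, mul_assoc, mul_inv_cancel₀, mul_one]
      exact_mod_cast hpos.ne'

end Gaussian

end ArakelovDivisor

/-- Gaussian functions are summable over lattices. -/
theorem summable_exp_neg_of_mul_norm_sq_le {E : Type*} [NormedAddCommGroup E] [NormedSpace ℝ E]
    [FiniteDimensional ℝ E] (L : Submodule ℤ E) [DiscreteTopology L] {q : E → ℝ} {a : ℝ}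
    (ha : 0 < a) (h : ∀ z, a * ‖z‖ ^ 2 ≤ q z) : Summable fun y : L => Real.exp (-q y) := by
  -- From `exp t ≥ t ^ n / n!` the terms are `O(‖y‖ ^ (-2n))`, summable once `2n` exceeds the rank.
  obtain ⟨n, hn⟩ : ∃ n, Module.finrank ℤ L < 2 * n := ⟨Module.finrank ℤ L + 1, by omega⟩
  have hs : Summable fun y : L => (n.factorial / a ^ n : ℝ) * ‖y‖⁻¹ ^ (2 * n) :=
    (ZLattice.summable_norm_pow_inv (L := L) (2 * n) hn).mul_left _
  refine Summable.of_norm_bounded_eventually hs ?_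
  filter_upwards [(Set.finite_singleton (0 : L)).compl_mem_cofinite] with y hy0
  have hy1 : 0 < ‖y‖ := norm_pos_iff.2 hy0
  have hk : 0 < a * ‖y‖ ^ 2 := by positivity
  have hpow := Real.pow_div_factorial_le_exp (a * ‖y‖ ^ 2) hk.le n
  have hle : Real.exp (a * ‖y‖ ^ 2) ≤ Real.exp (q y) := Real.exp_le_exp.2 (h y)
  rw [Real.norm_of_nonneg (Real.exp_nonneg _), Real.exp_neg]
  refine (inv_anti₀ (by positivity) (hpow.trans hle)).trans_eq ?_
  rw [mul_pow, inv_pow, pow_mul, inv_div]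
  field_simp

namespace ArakelovDivisor

open Ghost mixedEmbedding

variable {F : Type*} [Field F] [NumberField F]

/-! ### Lattice sums and the theta function. -/

section Lattice

variable (D : ArakelovDivisor F)

open scoped Classical in
theorem span_fractionalIdealLatticeBasis :
    (Submodule.span ℤ (Set.range (fractionalIdealLatticeBasis F D.ideal))).toAddSubgroup =
      D.lattice := by
  rw [span_idealLatticeBasis]

theorem mem_lattice {x : mixedSpace F} :
    x ∈ D.lattice ↔ ∃ a ∈ (D.ideal : FractionalIdeal (𝓞 F)⁰ F), mixedEmbedding F a = x :=
  mem_idealLattice F D.ideal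

instance : Countable D.lattice := by
  classical
  exact inferInstanceAs (Countable (idealLattice F D.ideal))

open scoped Classical in
theorem isAddFundamentalDomain_lattice :
    IsAddFundamentalDomain D.lattice.op
      (ZSpan.fundamentalDomain (fractionalIdealLatticeBasis F D.ideal)) volume := by
  refine IsAddFundamentalDomain.mk' (ZSpan.fundamentalDomain_measurableSet _).nullMeasurableSet
    fun x => ?_
  obtain ⟨⟨v, hv⟩, h1, h2⟩ :=
    ZSpan.exist_unique_vadd_mem_fundamentalDomain (fractionalIdealLatticeBasis F D.ideal) x
  have hmem : ∀ y, y ∈ Submodule.span ℤ (Set.range (fractionalIdealLatticeBasis F D.ideal)) ↔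
      y ∈ D.lattice := fun y => by rw [← D.span_fractionalIdealLatticeBasis]; rfl
  refine ⟨AddSubgroup.equivOp _ ⟨v, (hmem v).1 hv⟩, ?_, ?_⟩
  · change x + v ∈ _
    rw [add_comm]
    exact h1
  · intro g hg
    obtain ⟨⟨y, hy⟩, rfl⟩ := (AddSubgroup.equivOp _).surjective g
    have hg' : x + y ∈ ZSpan.fundamentalDomain (fractionalIdealLatticeBasis F D.ideal) := hg
    rw [add_comm] at hg'
    have := h2 ⟨y, (hmem y).2 hy⟩ hg'
    congr 2
    exact congrArg Subtype.val this

open scoped Classical in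
theorem exists_mul_norm_sq_le_normSq : ∃ a > 0, ∀ z : mixedSpace F, a * ‖z‖ ^ 2 ≤ D.normSq z := by
  obtain ⟨M, hM⟩ := Finite.exists_le D.2
  -- The `max` with `0` serves the complex places, where the exponent is `-x` and not `-2x`.
  refine ⟨Real.exp (-2 * max M 0), Real.exp_pos _, fun z => ?_⟩
  have h1 : ∀ σ, Real.exp (-2 * max M 0) * ‖z.1 σ‖ ^ 2 ≤ D.normSq z := fun σ => by
    have : Real.exp (-2 * max M 0) ≤ Real.exp (-2 * D.2 σ) :=
      Real.exp_le_exp.2 (by have := hM σ; have := le_max_left M 0; linarith)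
    calc _ ≤ |z.1 σ| ^ 2 * Real.exp (-2 * D.2 σ) := by
          rw [mul_comm, Real.norm_eq_abs]; gcongr
      _ ≤ ∑ σ : {w : InfinitePlace F // w.IsReal}, |z.1 σ| ^ 2 * Real.exp (-2 * D.2 σ) :=
          Finset.single_le_sum (f := fun σ : {w : InfinitePlace F // w.IsReal} =>
            |z.1 σ| ^ 2 * Real.exp (-2 * D.2 σ)) (fun σ _ => by positivity) (Finset.mem_univ σ)
      _ ≤ D.normSq z := le_add_of_nonneg_right (by positivity)
  have h2 : ∀ σ, Real.exp (-2 * max M 0) * ‖z.2 σ‖ ^ 2 ≤ D.normSq z := fun σ => by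
    have : Real.exp (-2 * max M 0) ≤ 2 * Real.exp (-D.2 σ) := by
      have : Real.exp (-2 * max M 0) ≤ Real.exp (-D.2 σ) := Real.exp_le_exp.2
        (by have := hM σ; have := le_max_left M 0; have := le_max_right M 0; linarith)
      linarith [Real.exp_pos (-D.2 σ)]
    calc _ ≤ ‖z.2 σ‖ ^ 2 * (2 * Real.exp (-D.2 σ)) := by
          rw [mul_comm]; gcongr
      _ ≤ ∑ σ : {w : InfinitePlace F // w.IsComplex}, ‖z.2 σ‖ ^ 2 * (2 * Real.exp (-D.2 σ)) :=
          Finset.single_le_sum (f := fun σ : {w : InfinitePlace F // w.IsComplex} =>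
            ‖z.2 σ‖ ^ 2 * (2 * Real.exp (-D.2 σ))) (fun σ _ => by positivity) (Finset.mem_univ σ)
      _ ≤ D.normSq z := le_add_of_nonneg_left (by positivity)
  have hs : ∀ r : ℝ, Real.exp (-2 * max M 0) * r ^ 2 ≤ D.normSq z ↔
      r ^ 2 ≤ D.normSq z / Real.exp (-2 * max M 0) := fun r => by
    rw [le_div_iff₀ (Real.exp_pos _), mul_comm]
  have hq : 0 ≤ D.normSq z / Real.exp (-2 * max M 0) :=
    div_nonneg (D.normSq_nonneg z) (Real.exp_pos _).le
  simp only [hs] at h1 h2 ⊢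
  have hz : ‖z‖ ≤ √(D.normSq z / Real.exp (-2 * max M 0)) :=
    max_le
      ((pi_norm_le_iff_of_nonneg (Real.sqrt_nonneg _)).2 fun σ => Real.le_sqrt_of_sq_le (h1 σ))
      ((pi_norm_le_iff_of_nonneg (Real.sqrt_nonneg _)).2 fun σ => Real.le_sqrt_of_sq_le (h2 σ))
  exact (pow_le_pow_left₀ (norm_nonneg z) hz 2).trans_eq (Real.sq_sqrt hq)

theorem summable_exp_neg_mul_normSq {c : ℝ} (hc : 0 < c) :
    Summable fun y : D.lattice => Real.exp (-c * D.normSq y) := by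
  classical
  obtain ⟨a, ha, h⟩ := D.exists_mul_norm_sq_le_normSq
  exact summable_exp_neg_of_mul_norm_sq_le (idealLattice F D.ideal) (mul_pos hc ha)
    (q := fun z => c * D.normSq z)
    (fun z => (mul_assoc c a _).trans_le (mul_le_mul_of_nonneg_left (h z) hc.le)) |>.congr
    fun _ => by rw [neg_mul]

theorem summable_gaussian : Summable D.H0 :=
  D.summable_exp_neg_mul_normSq Real.pi_pos

theorem finiteDimFirst_H0 : FiniteDimFirst Measure.count D.H0 :=
  ⟨(D.continuous_gaussian.comp continuous_subtype_val).aestronglyMeasurable,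
    hasFiniteIntegral_count_iff.2 D.summable_gaussian.norm⟩

theorem isFirstKind_H0 : IsFirstKind D.H0 := D.isFirstKind_gaussian.comp_subtype D.lattice

theorem gaussian_add_le (x y : mixedSpace F) :
    D.gaussian (x + y) ≤
      Real.exp (Real.pi * D.normSq x) * Real.exp (-(Real.pi / 2) * D.normSq y) := by
  rw [gaussian, ← Real.exp_add, Real.exp_le_exp]
  have := D.normSq_le_two_mul x y
  nlinarith [Real.pi_pos]

theorem summable_gaussian_add (x : mixedSpace F) :
    Summable fun y : D.lattice => D.gaussian (x + y) :=
  Summable.of_nonneg_of_le (fun _ => (D.gaussian_pos _).le) (fun y => D.gaussian_add_le x y)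
    ((D.summable_exp_neg_mul_normSq (half_pos Real.pi_pos)).mul_left _)

theorem continuous_tsum_gaussian_add :
    Continuous fun x : mixedSpace F => ∑' y : D.lattice, D.gaussian (x + y) := by
  rw [continuous_iff_continuousAt]
  intro x
  -- On this neighbourhood `normSq` is bounded, so `gaussian_add_le` gives one summable majorant.
  have hU : {z | D.normSq z < D.normSq x + 1} ∈ nhds x :=
    (isOpen_lt D.continuous_normSq continuous_const).mem_nhds (by simp)
  refine ContinuousOn.continuousAt (continuousOn_tsum (u := fun y : D.lattice =>
    Real.exp (Real.pi * (D.normSq x + 1)) * Real.exp (-(Real.pi / 2) * D.normSq y))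
    (fun y => (D.continuous_gaussian.comp (continuous_add_const _)).continuousOn)
    ((D.summable_exp_neg_mul_normSq (half_pos Real.pi_pos)).mul_left _) fun y z hz => ?_) hU
  rw [Real.norm_of_nonneg (D.gaussian_pos _).le]
  refine (D.gaussian_add_le z y).trans (mul_le_mul_of_nonneg_right ?_ (Real.exp_nonneg _))
  exact Real.exp_le_exp.2 (mul_le_mul_of_nonneg_left hz.le Real.pi_pos.le)

theorem integral_count_lattice {f : D.lattice → ℝ} (hf : Summable f) :
    ∫ y, f y ∂Measure.count = ∑' y, f y := by
  have hc : Continuous f := continuous_of_discreteTopology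
  rw [integral_countable ⟨hc.aestronglyMeasurable, hasFiniteIntegral_count_iff.2 hf.norm⟩]
  simp [Measure.real]

/-- The theta function of `D` on the torus `(F ⊗ ℝ) / I`. -/
def theta : mixedSpace F ⧸ D.lattice → ℝ :=
  Quotient.lift (fun x : mixedSpace F => ∑' y : D.lattice, D.gaussian (x + y)) (by
    intro a b hab
    have hab' : -a + b ∈ D.lattice := QuotientAddGroup.leftRel_apply.1 hab
    refine ((Equiv.addLeft (⟨-a + b, hab'⟩ : D.lattice)).tsum_eq
      fun y : D.lattice => D.gaussian (a + y)).symm.trans (tsum_congr fun y => ?_)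
    congr 1
    simp only [Equiv.coe_addLeft, AddSubgroup.coe_add]
    abel)

theorem theta_mk (x : mixedSpace F) :
    D.theta (x : mixedSpace F ⧸ D.lattice) = ∑' y : D.lattice, D.gaussian (x + y) := rfl

theorem continuous_theta : Continuous D.theta :=
  D.continuous_tsum_gaussian_add.quotient_lift _

theorem theta_pos (x : mixedSpace F ⧸ D.lattice) : 0 < D.theta x := by
  induction x using QuotientAddGroup.induction_on with | _ x
  exact (D.summable_gaussian_add x).tsum_pos (fun y => (D.gaussian_pos _).le) 0
    (D.gaussian_pos _)

theorem theta_neg (x : mixedSpace F ⧸ D.lattice) : D.theta (-x) = D.theta x := by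
  induction x using QuotientAddGroup.induction_on with | _ x
  rw [← QuotientAddGroup.mk_neg, theta_mk, theta_mk, ← (Equiv.neg D.lattice).tsum_eq]
  refine tsum_congr fun y => ?_
  rw [← D.gaussian_neg]
  congr 1
  simp
  abel

theorem cechQuotient_eq (x : mixedSpace F ⧸ D.lattice) :
    D.cechQuotient x = D.theta x / D.theta 0 := by
  induction x using QuotientAddGroup.induction_on with | _ x
  have h0 := D.summable_gaussian_add 0
  rw [← QuotientAddGroup.mk_zero, theta_mk, theta_mk]
  refine congrArg₂ (· / ·) (D.integral_count_lattice (D.summable_gaussian_add x)) ?_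
  simp only [zero_add] at h0 ⊢
  exact D.integral_count_lattice h0

end Lattice

/-! ### The dual lattice and Poisson summation. -/

section Duality

variable (D : ArakelovDivisor F)

theorem ideal_add (D E : ArakelovDivisor F) : (D + E).ideal = D.ideal * E.ideal :=
  Finsupp.prod_add_index' (fun P => by simp) fun P m n => by rw [neg_add, zpow_add]

/-- The fractional ideal of `K - D` is the dual, for the trace form, of that of `D`. -/
theorem ideal_canonical_sub :
    ((canonical F - D).ideal : FractionalIdeal (𝓞 F)⁰ F) =
      FractionalIdeal.dual ℤ ℚ (D.ideal : FractionalIdeal (𝓞 F)⁰ F) := by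
  have h := ideal_add (canonical F - D) D
  rw [sub_add_cancel] at h
  have h' : (canonical F - D).ideal = (canonical F).ideal * D.ideal⁻¹ := by
    rw [h, mul_inv_cancel_right]
  rw [h', FractionalIdeal.dual_eq_mul_inv, Units.val_mul, ideal_canonical,
    coeIdeal_differentIdeal ℤ ℚ F (𝓞 F), inv_inv, Units.val_inv_eq_inv_val]

theorem mem_ideal_canonical_sub {a : F} :
    a ∈ ((canonical F - D).ideal : FractionalIdeal (𝓞 F)⁰ F) ↔
      ∀ b ∈ (D.ideal : FractionalIdeal (𝓞 F)⁰ F), ∃ n : ℤ, (n : ℚ) = Algebra.trace ℚ F (a * b) := by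
  rw [ideal_canonical_sub, FractionalIdeal.mem_dual D.ideal.ne_zero]
  rfl

theorem exists_pairing_eq_intCast {w x : mixedSpace F} (hw : w ∈ (canonical F - D).lattice)
    (hx : x ∈ D.lattice) : ∃ n : ℤ, pairing w x = n := by
  obtain ⟨a, ha, rfl⟩ := (mem_lattice _).1 hw
  obtain ⟨b, hb, rfl⟩ := (mem_lattice _).1 hx
  obtain ⟨n, hn⟩ := (D.mem_ideal_canonical_sub).1 ha b hb
  exact ⟨n, by rw [pairing_mixedEmbedding, ← hn, Rat.cast_intCast]⟩

theorem fourierChar_eq_one_iff {t : ℝ} : Real.fourierChar t = 1 ↔ ∃ n : ℤ, t = n := by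
  rw [← Circle.coe_inj, Real.fourierChar_apply, Circle.coe_one, Complex.exp_eq_one_iff]
  refine exists_congr fun n => ?_
  have h : (2 * Real.pi * Complex.I : ℂ) ≠ 0 := Complex.two_pi_I_ne_zero
  rw [← Complex.ofReal_inj]
  push_cast
  rw [← mul_left_inj' (a := (t : ℂ)) h]
  constructor <;> intro e <;> linear_combination e

/-- A point that pairs integrally with the dual lattice belongs to the lattice. -/
theorem mem_lattice_of_pairing {x : mixedSpace F}
    (h : ∀ w ∈ (canonical F - D).lattice, ∃ n : ℤ, pairing w x = n) : x ∈ D.lattice := by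
  classical
  let b := basisOfFractionalIdeal F D.ideal
  let B := fractionalIdealLatticeBasis F D.ideal
  have hnd : (Algebra.traceForm ℚ F).Nondegenerate := traceForm_nondegenerate ℚ F
  -- The trace-dual basis lies in the ideal of `K - D`, and pairing with it reads off the
  -- coordinates of `x`, which are therefore integers.
  let b' := LinearMap.BilinForm.dualBasis (Algebra.traceForm ℚ F) hnd b
  have hbb : ∀ i j, Algebra.trace ℚ F (b' i * b j) = if j = i then 1 else 0 := fun i j =>
    LinearMap.BilinForm.apply_dualBasis_left hnd b i j
  have hb' : ∀ i, mixedEmbedding F (b' i) ∈ (canonical F - D).lattice := fun i => by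
    refine (mem_lattice _).2 ⟨_, (D.mem_ideal_canonical_sub).2 fun a ha => ?_, rfl⟩
    have ha' : a ∈ Submodule.span ℤ (Set.range b) :=
      (mem_span_basisOfFractionalIdeal F).2 ha
    clear ha
    induction ha' using Submodule.span_induction with
    | mem a h =>
      obtain ⟨j, rfl⟩ := h
      exact ⟨if j = i then 1 else 0, by rw [hbb]; split_ifs <;> simp⟩
    | zero => exact ⟨0, by simp⟩
    | add x y _ _ ix iy =>
      obtain ⟨m, hm⟩ := ix
      obtain ⟨n, hn⟩ := iy
      exact ⟨m + n, by rw [mul_add, map_add, ← hm, ← hn, Int.cast_add]⟩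
    | smul c x _ ix =>
      obtain ⟨m, hm⟩ := ix
      exact ⟨c * m, by rw [mul_smul_comm, map_zsmul, ← hm, zsmul_eq_mul, Int.cast_mul]⟩
  rw [← D.span_fractionalIdealLatticeBasis]
  change x ∈ Submodule.span ℤ (Set.range B)
  have hx : ∀ i, pairing (mixedEmbedding F (b' i)) x = B.repr x i := fun i => by
    conv_lhs => rw [← B.sum_repr x, pairing_sum_right]
    simp only [pairing_smul_right, B, fractionalIdealLatticeBasis_apply, pairing_mixedEmbedding]
    rw [Finset.sum_eq_single i]
    · rw [hbb]; simp
    · intro j _ hj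
      rw [hbb, if_neg hj]; simp
    · simp
  rw [← B.sum_repr x]
  refine Submodule.sum_mem _ fun i _ => ?_
  obtain ⟨n, hn⟩ := h _ (hb' i)
  rw [← hx i, hn, Int.cast_smul_eq_zsmul]
  exact Submodule.smul_mem _ _ (Submodule.subset_span ⟨i, rfl⟩)

theorem pairingChar_eq_one {w x : mixedSpace F} (hw : w ∈ (canonical F - D).lattice)
    (hx : x ∈ D.lattice) : pairingChar w x = 1 :=
  fourierChar_eq_one_iff.2 (D.exists_pairing_eq_intCast hw hx)

/-- The elements of the fractional ideal of `K - D` as characters of `(F ⊗ ℝ) / I`. -/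
def dualChar : AddChar (canonical F - D).lattice (AddChar (mixedSpace F ⧸ D.lattice) Circle) where
  toFun w := liftChar D.lattice (pairingChar w) fun _ hx => D.pairingChar_eq_one w.2 hx
  map_zero_eq_one' := by
    refine DFunLike.ext _ _ fun x => ?_
    induction x using QuotientAddGroup.induction_on with | _ x
    rw [liftChar_mk, AddChar.one_apply, pairingChar_apply, AddSubgroup.coe_zero,
      pairing_zero_left, AddChar.map_zero_eq_one]
  map_add_eq_mul' w v := by
    refine DFunLike.ext _ _ fun x => ?_
    induction x using QuotientAddGroup.induction_on with | _ x
    rw [AddChar.mul_apply, liftChar_mk, liftChar_mk, liftChar_mk, pairingChar_apply,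
      AddSubgroup.coe_add, pairing_add_left, AddChar.map_add_eq_mul]
    rfl

theorem dualChar_mk (w : (canonical F - D).lattice) (x : mixedSpace F) :
    D.dualChar w (x : mixedSpace F ⧸ D.lattice) = Real.fourierChar (pairing w x) := rfl

theorem continuous_dualChar (w : (canonical F - D).lattice) : Continuous (D.dualChar w) :=
  continuous_liftChar (continuous_pairingChar (w : mixedSpace F))
    fun _ hx => D.pairingChar_eq_one w.2 hx

theorem eq_zero_of_dualChar_eq_one {x : mixedSpace F ⧸ D.lattice}
    (h : ∀ w, D.dualChar w x = 1) : x = 0 := by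
  induction x using QuotientAddGroup.induction_on with | _ x
  exact (QuotientAddGroup.eq_zero_iff x).2 <| D.mem_lattice_of_pairing fun w hw =>
    fourierChar_eq_one_iff.1 (h ⟨w, hw⟩)

theorem eq_zero_of_forall_dualChar_eq_one {w : (canonical F - D).lattice}
    (h : ∀ x, D.dualChar w x = 1) : w = 0 := by
  refine Subtype.ext (pairing_nondegenerate fun x => ?_)
  by_contra hne
  obtain ⟨n, hn⟩ := fourierChar_eq_one_iff.1 ((D.dualChar_mk w _).symm.trans <|
    -- Rescaling makes the pairing equal to `1/2`, which is not an integer.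
    h (((2 * pairing (w : mixedSpace F) x)⁻¹ • x : mixedSpace F) : mixedSpace F ⧸ D.lattice))
  rw [pairing_smul_right, mul_inv, mul_assoc, inv_mul_cancel₀ hne, mul_one] at hn
  have h2 : (1 : ℝ) = ((2 * n : ℤ) : ℝ) := by push_cast; linarith
  have : (1 : ℤ) = 2 * n := by exact_mod_cast h2
  omega

theorem integral_dualChar [DecidableEq (canonical F - D).lattice] (w : (canonical F - D).lattice) :
    ∫ x, (D.dualChar w x : ℂ) ∂haarProb (mixedSpace F ⧸ D.lattice) = if w = 0 then 1 else 0 := by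
  split_ifs with hw
  · simp [hw]
  · have : ∃ a, D.dualChar w a ≠ 1 := by
      by_contra! hcon
      exact hw (D.eq_zero_of_forall_dualChar_eq_one hcon)
    obtain ⟨a, ha⟩ := this
    exact integral_char_eq_zero ha

/-- The Fourier series with the Gaussian coefficients of `K - D`. -/
def dualSeries (x : mixedSpace F ⧸ D.lattice) : ℂ :=
  ∑' w : (canonical F - D).lattice, ((canonical F - D).H0 w : ℂ) * D.dualChar w x

theorem continuous_dualSeries : Continuous D.dualSeries := by
  refine continuous_tsum (fun w => continuous_const.mul
    (continuous_coe_circle.comp (D.continuous_dualChar w)))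
    (canonical F - D).summable_gaussian.norm fun w x => ?_
  rw [norm_mul, Circle.norm_coe, mul_one, Complex.norm_real]

theorem integral_dualChar_mul_dualSeries (w : (canonical F - D).lattice) :
    ∫ x, (D.dualChar w x : ℂ) * D.dualSeries x ∂haarProb (mixedSpace F ⧸ D.lattice) =
      (canonical F - D).H0 w := by
  classical
  have hs := integral_tsum_of_summable_integral_norm
    (μ := haarProb (mixedSpace F ⧸ D.lattice))
    (F := fun v x => ((canonical F - D).H0 v : ℂ) * D.dualChar (w + v) x) (fun v =>
      (continuous_const.mul (continuous_coe_circle.comp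
        (D.continuous_dualChar _))).integrable_of_hasCompactSupport
        (HasCompactSupport.of_compactSpace _)) (by
      simpa only [norm_mul, Circle.norm_coe, mul_one, Complex.norm_real, integral_const,
        probReal_univ, one_smul] using (canonical F - D).summable_gaussian.norm)
  have e : ∀ x, (D.dualChar w x : ℂ) * D.dualSeries x =
      ∑' v, ((canonical F - D).H0 v : ℂ) * D.dualChar (w + v) x := fun x => by
    rw [dualSeries, ← tsum_mul_left]
    refine tsum_congr fun v => ?_
    rw [AddChar.map_add_eq_mul, AddChar.mul_apply, Circle.coe_mul]
    ring
  simp_rw [e]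
  -- By orthogonality only `v = -w` survives; the Gaussian is even.
  rw [← hs, tsum_eq_single (-w)]
  · rw [integral_const_mul, integral_dualChar]
    simp [H0, gaussian_neg]
  · intro v hv
    rw [integral_const_mul, integral_dualChar, if_neg, mul_zero]
    exact fun h => hv (eq_neg_of_add_eq_zero_right h)

/-- The mean value of the theta function. -/
def thetaMean : ℝ := ∫ x, D.theta x ∂haarProb (mixedSpace F ⧸ D.lattice)

theorem integral_dualChar_mul_theta (w : (canonical F - D).lattice) :
    ∫ x, (D.dualChar w x : ℂ) * D.theta x ∂haarProb (mixedSpace F ⧸ D.lattice) =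
      D.thetaMean * (canonical F - D).H0 w := by
  classical
  let s := ZSpan.fundamentalDomain (fractionalIdealLatticeBasis F D.ideal)
  have hs : volume s ≠ ⊤ := (ZSpan.fundamentalDomain_isBounded _).measure_lt_top.ne
  have key : ∀ w : (canonical F - D).lattice, (volume.real s : ℂ) *
      ∫ x, (D.dualChar w x : ℂ) * D.theta x ∂haarProb (mixedSpace F ⧸ D.lattice) =
      (canonical F - D).H0 w * ∫ z, (D.gaussian z : ℂ) := fun w => by
    rw [integral_mul_tsum_eq_integral_mul D.lattice volume D.isAddFundamentalDomain_lattice hs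
      (f := fun z => (D.gaussian z : ℂ)) D.integrable_gaussian.ofReal
      (g := fun x => (D.dualChar w x : ℂ)) (S := fun x => (D.theta x : ℂ))
      (continuous_coe_circle.comp (D.continuous_dualChar w))
      (Complex.continuous_ofReal.comp D.continuous_theta)
      (fun x => by rw [theta_mk, Complex.ofReal_tsum])]
    refine Eq.trans ?_
      (D.integral_gaussian_mul_fourierChar (E := canonical F - D) (by simp [canonical]) w)
    congr 1 with z
    rw [dualChar_mk, mul_comm]
  -- The case `w = 0` says that covolume times mean is the total mass, which eliminates both unknown
  -- constants.
  have h0 := key 0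
  have hH : (canonical F - D).H0 0 = 1 := gaussian_zero _
  simp only [AddChar.map_zero_eq_one, AddChar.one_apply, Circle.coe_one, one_mul, hH,
    Complex.ofReal_one, integral_complex_ofReal] at h0
  have hw := key w
  rw [integral_complex_ofReal, ← h0, mul_left_comm] at hw
  have hne : (volume.real s : ℂ) ≠ 0 := by
    intro h
    rw [h, zero_mul] at h0
    exact D.integral_gaussian_pos.ne (by exact_mod_cast h0)
  rw [mul_left_cancel₀ hne hw, thetaMean, mul_comm]

/-- Poisson summation. -/
theorem theta_eq_thetaMean_mul_dualSeries (x : mixedSpace F ⧸ D.lattice) :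
    (D.theta x : ℂ) = D.thetaMean * D.dualSeries x := by
  have hT : Continuous fun x => (D.theta x : ℂ) := Complex.continuous_ofReal.comp D.continuous_theta
  have hS : Continuous fun x => (D.thetaMean : ℂ) * D.dualSeries x :=
    continuous_const.mul D.continuous_dualSeries
  have h := eq_zero_of_integral_mul_char_eq_zero (haarProb (mixedSpace F ⧸ D.lattice)) D.dualChar
    D.continuous_dualChar (fun x => D.eq_zero_of_dualChar_eq_one)
    (d := fun x => (D.theta x : ℂ) - D.thetaMean * D.dualSeries x) (hT.sub hS) fun w => by
      have hc : Continuous fun x => (D.dualChar w x : ℂ) :=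
        continuous_coe_circle.comp (D.continuous_dualChar w)
      have h1 : Integrable (fun x => (D.dualChar w x : ℂ) * D.theta x) (haarProb _) :=
        (hc.mul hT).integrable_of_hasCompactSupport (HasCompactSupport.of_compactSpace _)
      have h2 : Integrable (fun x => (D.dualChar w x : ℂ) * (D.thetaMean * D.dualSeries x))
          (haarProb _) :=
        (hc.mul hS).integrable_of_hasCompactSupport (HasCompactSupport.of_compactSpace _)
      simp only [mul_sub]
      rw [integral_sub h1 h2, integral_dualChar_mul_theta]
      simp only [mul_left_comm _ (D.thetaMean : ℂ), integral_const_mul]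
      rw [integral_dualChar_mul_dualSeries, sub_self]
  exact sub_eq_zero.1 (congr_fun h x)

end Duality

/-! ### The ghost-spaces `H¹(D)` and the equality of dimensions. -/

section Cohomology

variable (D : ArakelovDivisor F)

theorem integrable_theta : Integrable D.theta (haarProb (mixedSpace F ⧸ D.lattice)) :=
  D.continuous_theta.integrable_of_hasCompactSupport (HasCompactSupport.of_compactSpace _)

theorem thetaMean_pos : 0 < D.thetaMean := by
  have h : Function.support D.theta = Set.univ :=
    Set.eq_univ_of_forall fun x => (D.theta_pos x).ne'
  rw [thetaMean, integral_pos_iff_support_of_nonneg (fun x => (D.theta_pos x).le)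
    D.integrable_theta, h]
  simp

/-- The density of `H¹(D)`. -/
def density (x : mixedSpace F ⧸ D.lattice) : ℝ := D.theta x / D.thetaMean

theorem coe_density (x : mixedSpace F ⧸ D.lattice) : (D.density x : ℂ) = D.dualSeries x := by
  have := D.thetaMean_pos.ne'
  rw [density, Complex.ofReal_div, theta_eq_thetaMean_mul_dualSeries, mul_div_cancel_left₀]
  exact_mod_cast this

theorem density_pos (x : mixedSpace F ⧸ D.lattice) : 0 < D.density x :=
  div_pos (D.theta_pos x) D.thetaMean_pos

theorem continuous_density : Continuous D.density := D.continuous_theta.div_const _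

theorem density_neg (x : mixedSpace F ⧸ D.lattice) : D.density (-x) = D.density x := by
  rw [density, theta_neg, density]

/-- Every character is `1` at the origin, so the Fourier series collapses to the sum of its
coefficients. -/
theorem density_zero : D.density 0 = ∑' w, (canonical F - D).H0 w := by
  have h := D.coe_density 0
  simp only [dualSeries, AddChar.map_zero_eq_one, Circle.coe_one, mul_one] at h
  exact_mod_cast h

theorem integral_density : ∫ x, D.density x ∂haarProb (mixedSpace F ⧸ D.lattice) = 1 := by
  simp only [density, integral_div]
  exact div_self D.thetaMean_pos.ne'

theorem H1_eq_withDensity :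
    D.H1 = (haarProb (mixedSpace F ⧸ D.lattice)).withDensity
      fun x => ENNReal.ofReal (D.density x) := by
  have hpos : 0 < D.thetaMean / D.theta 0 := div_pos D.thetaMean_pos (D.theta_pos 0)
  have hI : ∫⁻ x, ENNReal.ofReal (D.cechQuotient x) ∂haarProb (mixedSpace F ⧸ D.lattice) =
      ENNReal.ofReal (D.thetaMean / D.theta 0) := by
    simp only [cechQuotient_eq]
    rw [← ofReal_integral_eq_lintegral_ofReal (D.integrable_theta.div_const _)
      (.of_forall fun x => (div_pos (D.theta_pos x) (D.theta_pos 0)).le), integral_div, thetaMean]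
  rw [H1, quotientMeasure, hI, ← withDensity_smul']
  · congr 1
    funext x
    rw [Pi.smul_apply, smul_eq_mul, ← ENNReal.ofReal_inv_of_pos hpos,
      ← ENNReal.ofReal_mul (inv_nonneg.2 hpos.le), cechQuotient_eq, density]
    congr 1
    have := (D.theta_pos 0).ne'
    have := D.thetaMean_pos.ne'
    field_simp
  · rw [ne_eq, ENNReal.inv_eq_top, ENNReal.ofReal_eq_zero, not_le]
    exact hpos

theorem isDensity_density : IsDensity (haarProb _) D.H1 D.density where
  continuous := D.continuous_density
  nonneg x := (D.density_pos x).le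
  eq_withDensity := D.H1_eq_withDensity

theorem finiteDimSecond_H1 : FiniteDimSecond (haarProb _) D.H1 :=
  ⟨D.density, D.isDensity_density, D.density_pos 0⟩

theorem isSecondKind_H1 : IsSecondKind D.H1 where
  isProbability := by
    refine ⟨?_⟩
    rw [H1_eq_withDensity, withDensity_apply _ MeasurableSet.univ, Measure.restrict_univ,
      ← ofReal_integral_eq_lintegral_ofReal (f := D.density) (D.integrable_theta.div_const _)
        (.of_forall fun x => (D.density_pos x).le), D.integral_density, ENNReal.ofReal_one]
  even := by
    have hm : Measurable fun x => ENNReal.ofReal (D.density x) :=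
      ENNReal.measurable_ofReal.comp D.continuous_density.measurable
    rw [H1_eq_withDensity]
    exact map_neg_withDensity hm fun x => by rw [density_neg]
  posDef := by
    rw [H1_eq_withDensity]
    exact posDefMeasure_withDensity (canonical F - D).summable_gaussian
      (fun w => ((canonical F - D).gaussian_pos _).le) D.dualChar D.continuous_dualChar
      D.continuous_density (fun x => (D.density_pos x).le) fun x => D.coe_density x

theorem isFirstKind_cechQuotient : IsFirstKind D.cechQuotient where
  pos x := by
    rw [cechQuotient_eq]
    exact div_pos (D.theta_pos x) (D.theta_pos 0)
  map_zero := by rw [cechQuotient_eq, div_self (D.theta_pos 0).ne']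
  continuous := by
    simp only [funext D.cechQuotient_eq]
    exact D.continuous_theta.div_const _
  posDef := by
    set E := canonical F - D with hE
    have hsum : Summable fun w => (D.density 0)⁻¹ * E.H0 w := E.summable_gaussian.mul_left _
    have hmeas : ∀ f : E.lattice → ℂ, Measurable f := fun f =>
      (continuous_of_discreteTopology (f := f)).measurable
    -- By Poisson summation the quotient function is a Fourier series with positive coefficients;
    -- dividing by `density 0` normalizes it at the origin.
    refine posDefFun_of_eq_integral Measure.count (p := fun w => (D.density 0)⁻¹ * E.H0 w)
      (E.finiteDimFirst_H0.const_mul _)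
      (fun w => mul_nonneg (inv_nonneg.2 (D.density_pos 0).le) (E.gaussian_pos _).le)
      D.dualChar (fun x => hmeas _) fun x => ?_
    rw [integral_countable]
    · simp only [Measure.real, Measure.count_singleton, ENNReal.toReal_one, one_smul,
        Complex.ofReal_mul, mul_assoc, tsum_mul_left]
      have hx : ∑' w, (E.H0 w : ℂ) * D.dualChar w x = D.dualSeries x := rfl
      rw [hx, ← coe_density, cechQuotient_eq, ← Complex.ofReal_mul]
      congr 1
      simp only [density]
      have := (D.theta_pos 0).ne'
      have := D.thetaMean_pos.ne'
      field_simp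
    · refine ⟨(hmeas _).aestronglyMeasurable, hasFiniteIntegral_count_iff.2 ?_⟩
      simpa only [norm_mul, Circle.norm_coe, mul_one, Complex.norm_real] using hsum.norm

theorem h1_eq_h0 : D.h1 = (canonical F - D).h0 := by
  have hex : ∃ f, IsDensity (haarProb _) D.H1 f := ⟨_, D.isDensity_density⟩
  -- The dimension is defined through a chosen density; uniqueness of continuous densities
  -- identifies it.
  have hu : hex.choose = D.density := hex.choose_spec.unique D.isDensity_density
  rw [h1, absDimSecond, dimSecond, dif_pos hex, hu, density_zero, h0, absDimFirst, dimFirst,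
    integral_count_lattice _ (canonical F - D).summable_gaussian]

end Cohomology

end ArakelovDivisor

end

theorem corollary5p1 (F : Type*) [Field F] [NumberField F] (D : ArakelovDivisor F) :
    -- `H⁰(K - D)` is a finite-dimensional ghost-space of the first kind
    Ghost.IsFirstKind (ArakelovDivisor.canonical F - D).H0 ∧
    Ghost.FiniteDimFirst MeasureTheory.Measure.count (ArakelovDivisor.canonical F - D).H0 ∧
    -- the ghost-spaces of the first kind from which `H¹(D)` is built are well-defined
    Ghost.IsFirstKind D.gaussian ∧
    Ghost.IsFirstKind D.H0 ∧
    Ghost.FiniteDimFirst MeasureTheory.Measure.count D.H0 ∧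
    Ghost.IsFirstKind D.cechQuotient ∧
    -- `H¹(D)` is a finite-dimensional ghost-space of the second kind
    Ghost.IsSecondKind D.H1 ∧
    Ghost.FiniteDimSecond (Ghost.haarProb _) D.H1 ∧
    -- the equality of dimensions
    D.h1 = (ArakelovDivisor.canonical F - D).h0 :=
  ⟨ArakelovDivisor.isFirstKind_H0 _, ArakelovDivisor.finiteDimFirst_H0 _, D.isFirstKind_gaussian,
    D.isFirstKind_H0, D.finiteDimFirst_H0, D.isFirstKind_cechQuotient, D.isSecondKind_H1,
    D.finiteDimSecond_H1, D.h1_eq_h0⟩
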